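/- Theorem (algebraically closed complete normed fields have the perfect interpolation property). Let $\mathbb{F}$ be an algebraically closed field that is complete with respect to a nontrivial norm, i.e. a function $|\cdot|:\mathbb{F}\to[0,\infty)$ with $|x|=0$ iff $x=0$, $|xy|=|x||y|$, $|x+y|\le|x|+|y|$, and $|x|>1$ for some $x$. Let $d\ge 0$ and $\mathbb{B}^d=\{x\in\mathbb{F}^d : |x_j|<1 \text{ for all } j\}$. For a polynomial $h\in\mathbb{F}[x_1,\dots,x_d]$ let $\|h\|$ be the sum of the norms of its coefficients, $\deg h$ its total degree (with $\deg 0=0$), and, for $X\subseteq\mathbb{B}^d$, let $\|h\|_X=\sup_{x\in X}|h(x)|$. Let $X_0\subseteq X_1\subseteq X_2\subseteq\cdots$ be subsets of $\mathbb{B}^d$, closed in the relative topology of $\mathbb{B}^d$ (in particular, they may be closed subsets of $\mathbb{F}^d$), with $\bigcup_i X_i=\mathbb{B}^d$. Then there are real numbers $B_i$ with $B_i\to 1$ and real numbers $A_i>0$ such that, for all sufficiently large $i$ and all polynomials $h\in\mathbb{F}[x_1,\dots,x_d]$, $$\|h\|\le A_i\,B_i^{\deg h}\,\|h\|_{X_i}.$$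 -/

import Mathlib

open Filter Topology

/-- The open unit polydisk `𝔹^d`: points of `F^d` all of whose coordinates have norm `< 1`. -/
def openUnitPolydisk (F : Type*) [NormedField F] (d : ℕ) : Set (Fin d → F) :=
  {x | ∀ j, ‖x j‖ < 1}

/-- `‖h‖`: the sum of the norms of the coefficients of `h`. -/
noncomputable def coeffNorm {F : Type*} [NormedField F] {d : ℕ}
    (h : MvPolynomial (Fin d) F) : ℝ :=
  ∑ m ∈ h.support, ‖h.coeff m‖

/-- `‖h‖_X`: the supremum of `|h|` over `X`. It is used only for subsets `X` of the open unit
polydisk, where `|h|` is bounded by `‖h‖` (see `norm_eval_le_coeffNorm`). -/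
noncomputable def supNormOn {F : Type*} [NormedField F] {d : ℕ}
    (X : Set (Fin d → F)) (h : MvPolynomial (Fin d) F) : ℝ :=
  ⨆ x : X, ‖MvPolynomial.eval (x : Fin d → F) h‖

theorem norm_eval_le_coeffNorm {F : Type*} [NormedField F] {d : ℕ}
    (h : MvPolynomial (Fin d) F) {x : Fin d → F} (hx : x ∈ openUnitPolydisk F d) :
    ‖MvPolynomial.eval x h‖ ≤ coeffNorm h := by
  rw [MvPolynomial.eval_eq', coeffNorm]
  refine (norm_sum_le _ _).trans (Finset.sum_le_sum fun m _ => ?_)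
  rw [norm_mul, norm_prod]
  refine mul_le_of_le_one_right (norm_nonneg _) ?_
  refine Finset.prod_le_one (fun j _ => norm_nonneg _) fun j _ => ?_
  rw [norm_pow]
  exact pow_le_one₀ (norm_nonneg _) (hx j).le

/-- The perfect interpolation property. For every `d` and every increasing sequence of subsets
`X i`, relatively closed in the open unit polydisk and with union the polydisk, there are reals
`B i → 1` and `A i > 0` such that, for all large `i`, every polynomial `h` satisfies
`‖h‖ ≤ A i * B i ^ deg h * ‖h‖_{X i}`, where `deg` is the total degree.
(The first few `X i` may be empty or finite, hence "for all large `i`".) -/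
def PerfectInterpolationProperty (F : Type*) [NormedField F] : Prop :=
  ∀ (d : ℕ) (X : ℕ → Set (Fin d → F)),
    Monotone X →
    (∀ i, IsClosed ((↑) ⁻¹' X i : Set (openUnitPolydisk F d))) →
    (⋃ i, X i) = openUnitPolydisk F d →
    ∃ A B : ℕ → ℝ, (∀ i, 0 < A i) ∧ Tendsto B atTop (𝓝 1) ∧
      ∀ᶠ i in atTop, ∀ h : MvPolynomial (Fin d) F,
        coeffNorm h ≤ A i * B i ^ h.totalDegree * supNormOn (X i) h

/-! By a diagonal choice of `B i` it suffices to fix `B > 1` and find a constant for each large `i`.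
The plan is a Remez-type inequality: a probability measure carried to the open disc such that a
bound on any set of almost full measure bounds all coefficients, with a loss `A * B ^ n` in degree
`n`. On the `d`-fold product the preimages of the `X i` increase to everything, so their complements
have measure tending to `0`; Fubini and induction on `d` then reduce to one variable, and the number
of monomials is only polynomial in the degree.

The measure is a Haar measure, so a finite node set has a translate with few nodes outside `E`. The
bad nodes are killed by multiplying `p` with the polynomial `w` vanishing there, and `p * w` is
recovered from its values at the nodes. If the integers are unbounded, Ostrowski embeds `ℂ` in `F`:
the nodes are roots of unity on a circle of radius close to `1`, and interpolation is the discrete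
Fourier transform. Otherwise `F` is ultrametric with infinitely many residue classes: the nodes are
digit expansions with many digits, and Lagrange interpolation is measured by the multiplicative
Gauss norm. -/

open MeasureTheory Polynomial in
/-- The field `F` carries a probability measure on a continuous family of points of the open unit disc for which
every set of almost full measure controls all coefficients of polynomials of degree at most `n` up
to a factor `A * B ^ n`. -/
def HasRemezMeasure (F : Type*) [NormedField F] (B : ℝ) : Prop :=
  ∃ (Ω : Type) (_ : TopologicalSpace Ω) (_ : SecondCountableTopology Ω) (_ : MeasurableSpace Ω)
    (_ : BorelSpace Ω) (μ : Measure Ω) (_ : IsProbabilityMeasure μ) (φ : Ω → F) (ε : NNReal)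
    (A : ℝ), Continuous φ ∧ (∀ ω, ‖φ ω‖ < 1) ∧ 0 < ε ∧ 0 < A ∧
      ∀ E : Set Ω, MeasurableSet E → μ Eᶜ ≤ ε → ∀ (n : ℕ) (p : F[X]) (M : ℝ),
        p.natDegree ≤ n → 0 ≤ M → (∀ ω ∈ E, ‖p.eval (φ ω)‖ ≤ M) →
          ∀ k, ‖p.coeff k‖ ≤ A * B ^ n * M

/-! ### Averaging over translates, and elementary estimates -/

-- The expected number of `w` with `T w x ∉ E` is at most `ε * W.card`, and some `x` does no worse
-- than the mean.
open MeasureTheory in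
theorem exists_card_filter_notMem_le {Ω ι : Type*} [MeasurableSpace Ω] (μ : Measure Ω)
    [IsProbabilityMeasure μ] (W : Finset ι) (T : ι → Ω → Ω)
    (hT : ∀ w ∈ W, MeasurePreserving (T w) μ μ) {E : Set Ω} (hE : MeasurableSet E) {ε : NNReal}
    (hμ : μ Eᶜ ≤ ε) [∀ x, DecidablePred fun w => T w x ∉ E] :
    ∃ x, ((W.filter fun w => T w x ∉ E).card : ℝ) ≤ ε * W.card := by
  have hmeas : ∀ w ∈ W, Measurable ((T w ⁻¹' Eᶜ).indicator fun _ => (1 : ENNReal)) := fun w hw =>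
    measurable_const.indicator ((hT w hw).measurable hE.compl)
  obtain ⟨x, hx⟩ := exists_le_lintegral (μ := μ)
    (f := fun x => ∑ w ∈ W, (T w ⁻¹' Eᶜ).indicator (fun _ => (1 : ENNReal)) x)
    (Finset.measurable_fun_sum W hmeas).aemeasurable
  refine ⟨x, ?_⟩
  rw [lintegral_finsetSum' W fun w hw => (hmeas w hw).aemeasurable] at hx
  have h1 : ∀ w ∈ W, ∫⁻ a, (T w ⁻¹' Eᶜ).indicator (fun _ => (1 : ENNReal)) a ∂μ ≤ ε := by
    intro w hw
    rw [lintegral_indicator_const ((hT w hw).measurable hE.compl), one_mul,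
      (hT w hw).measure_preimage hE.compl.nullMeasurableSet]
    exact hμ
  have h2 := hx.trans (Finset.sum_le_sum h1)
  have h3 : ∑ w ∈ W, (T w ⁻¹' Eᶜ).indicator (fun _ => (1 : ENNReal)) x =
      ((W.filter fun w => T w x ∉ E).card : ENNReal) := by
    rw [Finset.card_filter, Nat.cast_sum]
    refine Finset.sum_congr rfl fun w _ => ?_
    by_cases h : T w x ∈ E <;> simp [h]
  rw [h3, Finset.sum_const, nsmul_eq_mul, mul_comm] at h2
  exact_mod_cast h2

theorem exists_one_lt_pow_le {B : ℝ} (hB : 1 < B) (k : ℕ) : ∃ b : ℝ, 1 < b ∧ b ^ k ≤ B := by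
  have h : Tendsto (fun b : ℝ => b ^ k) (𝓝[>] 1) (𝓝 1) := by
    simpa using ((continuous_pow k).tendsto (1 : ℝ)).mono_left nhdsWithin_le_nhds
  obtain ⟨b, hb, hb'⟩ := ((h.eventually (eventually_le_nhds hB)).and self_mem_nhdsWithin).exists
  exact ⟨b, hb', hb⟩

theorem exists_add_one_pow_le_mul_pow {B : ℝ} (hB : 1 < B) (k : ℕ) :
    ∃ C : ℝ, 0 < C ∧ ∀ n : ℕ, ((n : ℝ) + 1) ^ k ≤ C * B ^ n := by
  have h := (tendsto_pow_const_div_const_pow_of_one_lt k hB).bddAbove_range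
  obtain ⟨C, hC⟩ := h
  have hB0 : 0 < B := zero_lt_one.trans hB
  refine ⟨(|C| + 1) * B, by positivity, fun n => ?_⟩
  have h1 := hC ⟨n + 1, rfl⟩
  simp only [Nat.cast_add, Nat.cast_one] at h1
  rw [div_le_iff₀ (by positivity)] at h1
  have h2 : C ≤ |C| + 1 := (le_abs_self C).trans (by linarith)
  calc ((n : ℝ) + 1) ^ k ≤ C * B ^ (n + 1) := h1
    _ ≤ (|C| + 1) * B ^ (n + 1) := by gcongr
    _ = _ := by ring

/-- Roots of high order of a nonzero element of norm below `1` have norms tending to `1`. -/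
theorem exists_lt_norm_lt_one_of_isAlgClosed (F : Type*) [NontriviallyNormedField F]
    [IsAlgClosed F] {r : ℝ} (hr0 : 0 ≤ r) (hr : r < 1) : ∃ c : F, r < ‖c‖ ∧ ‖c‖ < 1 := by
  obtain ⟨x, hx0, hx1⟩ := NormedField.exists_norm_lt_one F
  obtain ⟨s, hs⟩ := exists_pow_lt_of_lt_one hx0 hr
  have hs' : r ^ (s + 1) < ‖x‖ := (pow_le_pow_of_le_one hr0 hr.le s.le_succ).trans_lt hs
  obtain ⟨c, hc⟩ := IsAlgClosed.exists_pow_nat_eq x s.succ_pos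
  have hc' : ‖c‖ ^ (s + 1) = ‖x‖ := by rw [← norm_pow, hc]
  refine ⟨c, ?_, ?_⟩
  · exact lt_of_pow_lt_pow_left₀ (s + 1) (norm_nonneg c) (hs'.trans_eq hc'.symm)
  · by_contra! h
    exact absurd (one_le_pow₀ h (n := s + 1)) (by rw [hc']; exact hx1.not_ge)

/-! ### The archimedean case: circles in an embedded copy of `ℂ` -/

/-- By Ostrowski the norm on `ℚ` is a power of the usual one, so `ℚ → F` extends to `ℝ` by
completeness, and a square root of `-1` extends it to `ℂ`. -/
theorem exists_complex_ringHom_of_not_bounded (F : Type*) [NormedField F] [CompleteSpace F]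
    [IsAlgClosed F] (hF : ¬ ∀ n : ℕ, ‖(n : F)‖ ≤ 1) :
    ∃ f : ℂ →+* F, Continuous f ∧ (∀ z, ‖z‖ = 1 → ‖f z‖ = 1) ∧
      ∀ n : ℕ, n ≠ 0 → 1 ≤ ‖(n : F)‖ := by
  -- If a positive `n` vanished in `F`, all powers of an integer of norm above `1` would reduce mod
  -- `n` and stay bounded.
  have hchar : CharZero F := by
    refine charZero_of_inj_zero fun n hn => ?_
    by_contra h0
    obtain ⟨m, hm⟩ := not_forall.1 hF
    obtain ⟨k, hk⟩ := pow_unbounded_of_one_lt (n : ℝ) (not_le.1 hm)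
    have h1 : ((m ^ k : ℕ) : F) = ((m ^ k % n : ℕ) : F) := by
      conv_lhs => rw [← Nat.mod_add_div (m ^ k) n]
      simp [hn]
    have h2 : ‖((m ^ k : ℕ) : F)‖ ≤ (m ^ k % n : ℕ) := by
      rw [h1]
      simpa using Nat.norm_cast_le (α := F) (m ^ k % n)
    have h3 : ((m ^ k % n : ℕ) : ℝ) ≤ n := by
      exact_mod_cast (Nat.mod_lt _ (Nat.pos_of_ne_zero h0)).le
    rw [Nat.cast_pow, norm_pow] at h2
    linarith
  let v : AbsoluteValue ℚ ℝ := (NormedField.toAbsoluteValue F).comp (algebraMap ℚ F).injective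
  have hv : ∀ q : ℚ, v q = ‖(q : F)‖ := fun q => rfl
  have hequiv := Rat.AbsoluteValue.equiv_real_of_unbounded (f := v) (by simpa [hv] using hF)
  obtain ⟨c, hc, hcv⟩ := AbsoluteValue.isEquiv_iff_exists_rpow_eq.1 hequiv.symm
  have hnorm : ∀ q : ℚ, ‖(q : F)‖ = |(q : ℝ)| ^ c := fun q => by
    rw [← hv, ← congrFun hcv q]; simp
  have huc : UniformContinuous (algebraMap ℚ F) := by
    refine uniformContinuous_of_continuousAt_zero (algebraMap ℚ F) ?_
    rw [ContinuousAt, map_zero, tendsto_zero_iff_norm_tendsto_zero]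
    have : Continuous fun q : ℚ => |(q : ℝ)| ^ c :=
      (Real.continuous_rpow_const hc.le).comp (continuous_abs.comp Rat.continuous_coe_real)
    simpa [hnorm, hc.ne'] using this.tendsto 0
  let g : ℝ →+* F := IsDenseInducing.extendRingHom (i := Rat.castHom ℝ) (f := algebraMap ℚ F)
    Rat.isUniformEmbedding_coe_real.isUniformInducing Rat.isDenseEmbedding_coe_real.dense huc
  have hg : Continuous g :=
    (uniformContinuous_uniformly_extend Rat.isUniformEmbedding_coe_real.isUniformInducing
      Rat.isDenseEmbedding_coe_real.dense huc).continuous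
  obtain ⟨i, hi⟩ := IsAlgClosed.exists_pow_nat_eq (-1 : F) two_pos
  let _ : Algebra ℝ F := g.toAlgebra
  let f : ℂ →ₐ[ℝ] F := Complex.lift ⟨i, by rw [← hi, sq]⟩
  have hf : ∀ z : ℂ, f z = g z.re + g z.im * i := fun z => by
    simp [f, Complex.liftAux_apply, Algebra.smul_def, RingHom.algebraMap_toAlgebra]
  have hfc : Continuous f := by
    have : (f : ℂ → F) = fun z => g z.re + g z.im * i := funext hf
    rw [this]
    exact (hg.comp Complex.continuous_re).add ((hg.comp Complex.continuous_im).mul continuous_const)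
  -- `f` is bounded on the compact circle, which contains all powers of `z`.
  have hle : ∀ z : ℂ, ‖z‖ = 1 → ‖f z‖ ≤ 1 := by
    intro z hz
    obtain ⟨K, hK⟩ := (isCompact_sphere (0 : ℂ) 1).exists_bound_of_continuousOn hfc.continuousOn
    by_contra! h
    obtain ⟨m, hm⟩ := pow_unbounded_of_one_lt K h
    have := hK (z ^ m) (by simp [hz])
    rw [map_pow, norm_pow] at this
    linarith
  refine ⟨f, hfc, fun z hz => le_antisymm (hle z hz) ?_, fun n hn => ?_⟩
  · have h1 := hle z⁻¹ (by simp [hz])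
    have hz0 : z ≠ 0 := by rintro rfl; simp at hz
    have h2 : ‖f z‖ * ‖f z⁻¹‖ = 1 := by
      rw [← norm_mul, ← map_mul, mul_inv_cancel₀ hz0, map_one, norm_one]
    by_contra! h
    have h3 : ‖f z‖ * ‖f z⁻¹‖ ≤ ‖f z‖ := mul_le_of_le_one_right (norm_nonneg _) h1
    exact absurd h (not_lt.2 (h2.symm.le.trans h3))
  · have := hnorm n
    simp only [Rat.cast_natCast] at this
    rw [this]
    refine Real.one_le_rpow ?_ hc.le
    rw [Nat.abs_cast]
    exact_mod_cast Nat.one_le_iff_ne_zero.2 hn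

-- Fourier inversion on the `N`-th roots of unity; the exponent `N - k` replaces `-k`.
open Polynomial in
theorem IsPrimitiveRoot.sum_eval_mul_pow_sub {R : Type*} [CommRing R] [IsDomain R] {ζ : R} {N : ℕ}
    (hζ : IsPrimitiveRoot ζ N) {g : R[X]} (hg : g.natDegree < N) (y : R) {k : ℕ} (hk : k < N) :
    ∑ j ∈ Finset.range N, g.eval (y * ζ ^ j) * (ζ ^ j) ^ (N - k) = N * (g.coeff k * y ^ k) := by
  have key : ∀ i ∈ Finset.range N, ∑ j ∈ Finset.range N, (ζ ^ (i + (N - k))) ^ j =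
      if i = k then (N : R) else 0 := by
    intro i hi
    rw [Finset.mem_range] at hi
    split_ifs with hik
    · have : ζ ^ (i + (N - k)) = 1 := by
        rw [hik, Nat.add_sub_cancel' hk.le, hζ.pow_eq_one]
      simp [this]
    · have hne : ζ ^ (i + (N - k)) ≠ 1 := by
        rw [Ne, hζ.pow_eq_one_iff_dvd]
        rintro ⟨c, hc⟩
        have : c = 1 := by
          have h1 : 0 < c := by
            rcases Nat.eq_zero_or_pos c with rfl | h
            · omega
            · exact h
          have h2 : c < 2 := by
            by_contra! h
            have := Nat.mul_le_mul_left N h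
            omega
          omega
        subst this
        omega
      have h0 : (ζ ^ (i + (N - k)) - 1) * ∑ j ∈ Finset.range N, (ζ ^ (i + (N - k))) ^ j = 0 := by
        rw [mul_geom_sum, ← pow_mul, mul_comm, pow_mul, hζ.pow_eq_one, one_pow, sub_self]
      exact (mul_eq_zero.1 h0).resolve_left (sub_ne_zero.2 hne)
  calc ∑ j ∈ Finset.range N, g.eval (y * ζ ^ j) * (ζ ^ j) ^ (N - k)
      = ∑ j ∈ Finset.range N, ∑ i ∈ Finset.range N,
          g.coeff i * y ^ i * (ζ ^ (i + (N - k))) ^ j := by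
        refine Finset.sum_congr rfl fun j _ => ?_
        rw [eval_eq_sum_range' hg, Finset.sum_mul]
        refine Finset.sum_congr rfl fun i _ => ?_
        ring
    _ = ∑ i ∈ Finset.range N, if i = k then (N : R) * (g.coeff k * y ^ k) else 0 := by
        rw [Finset.sum_comm]
        refine Finset.sum_congr rfl fun i hi => ?_
        rw [← Finset.mul_sum, key i hi]
        split_ifs with hik
        · subst hik; ring
        · simp
    _ = _ := by simp [hk]

open Polynomial in
theorem norm_coeff_mul_pow_le_of_norm_eval_le {F : Type*} [NormedField F] {ζ : F} {N : ℕ}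
    (hζ : IsPrimitiveRoot ζ N) (hN : 1 ≤ ‖(N : F)‖) {g : F[X]} (hg : g.natDegree < N) (y : F)
    {M : ℝ} (hM : ∀ j < N, ‖g.eval (y * ζ ^ j)‖ ≤ M) (k : ℕ) :
    ‖g.coeff k‖ * ‖y‖ ^ k ≤ N * M := by
  have hM0 : 0 ≤ M := (norm_nonneg _).trans (hM 0 (by omega))
  rcases lt_or_ge k N with hk | hk
  · have hζ1 : ‖ζ‖ = 1 := (pow_eq_one_iff_of_nonneg (norm_nonneg ζ) (by omega : N ≠ 0)).1
      (by rw [← norm_pow, hζ.pow_eq_one, norm_one])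
    have h := hζ.sum_eval_mul_pow_sub hg y hk
    calc ‖g.coeff k‖ * ‖y‖ ^ k ≤ ‖(N : F)‖ * (‖g.coeff k‖ * ‖y‖ ^ k) :=
          le_mul_of_one_le_left (by positivity) hN
      _ = ‖∑ j ∈ Finset.range N, g.eval (y * ζ ^ j) * (ζ ^ j) ^ (N - k)‖ := by
          rw [h]; simp
      _ ≤ ∑ j ∈ Finset.range N, M := by
          refine norm_sum_le_of_le _ fun j hj => ?_
          simpa [hζ1] using hM j (Finset.mem_range.1 hj)
      _ = N * M := by simp
  · rw [coeff_eq_zero_of_natDegree_lt (hg.trans_le hk)]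
    simpa using by positivity

open Polynomial in
/-- Coefficient bound for a polynomial which is known to be small at all but few of the points
`y * ζ ^ j` of a circle of radius `‖y‖ < 1`. -/
theorem norm_coeff_le_of_norm_eval_le_off_few {F : Type*} [NormedField F] {ζ : F} {N : ℕ}
    (hζ : IsPrimitiveRoot ζ N) (hN : 1 ≤ ‖(N : F)‖) {p : F[X]} {y : F} (hy0 : y ≠ 0)
    (hy1 : ‖y‖ < 1) (T : Finset ℕ) (hdeg : p.natDegree + T.card < N)
    {M : ℝ} (hM0 : 0 ≤ M) (hM : ∀ j < N, j ∉ T → ‖p.eval (y * ζ ^ j)‖ ≤ M) (k : ℕ) :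
    ‖p.coeff k‖ ≤ N ^ 3 * (2 / (1 - ‖y‖)) ^ T.card * (‖y‖⁻¹) ^ N * M := by
  have hζ1 : ‖ζ‖ = 1 := (pow_eq_one_iff_of_nonneg (norm_nonneg ζ) (by omega : N ≠ 0)).1
      (by rw [← norm_pow, hζ.pow_eq_one, norm_one])
  have hyp : 0 < ‖y‖ := norm_pos_iff.2 hy0
  have hy2 : 0 < 1 - ‖y‖ := sub_pos.2 hy1
  set t := T.card with ht
  set w : F[X] := ∏ i ∈ T, (X - C (y * ζ ^ i)) with hw
  have hwdeg : w.natDegree = t := by rw [hw, natDegree_finsetProd_X_sub_C_eq_card]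
  have hgdeg : (p * w).natDegree < N := natDegree_mul_le.trans_lt (by omega)
  have hgM : ∀ j < N, ‖(p * w).eval (y * ζ ^ j)‖ ≤ M * 2 ^ t := by
    intro j hj
    by_cases hjT : j ∈ T
    · have : w.eval (y * ζ ^ j) = 0 := by
        rw [hw, eval_prod]
        exact Finset.prod_eq_zero hjT (by simp)
      rw [eval_mul, this, mul_zero, norm_zero]
      positivity
    · rw [eval_mul, norm_mul]
      refine mul_le_mul (hM j hj hjT) ?_ (norm_nonneg _) hM0
      rw [hw, eval_prod, norm_prod, ht, ← Finset.prod_const]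
      refine Finset.prod_le_prod (fun _ _ => norm_nonneg _) fun i _ => ?_
      simp only [eval_sub, eval_X, eval_C]
      refine (norm_sub_le _ _).trans ?_
      simp only [norm_mul, norm_pow, hζ1, one_pow, mul_one]
      linarith
  have hgc : ∀ i < N, ‖(p * w).coeff i‖ ≤ N * (M * 2 ^ t) * (‖y‖⁻¹) ^ N := by
    intro i hi
    have h := norm_coeff_mul_pow_le_of_norm_eval_le hζ hN hgdeg y hgM i
    have h1 : ‖y‖ ^ N ≤ ‖y‖ ^ i := pow_le_pow_of_le_one hyp.le hy1.le hi.le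
    rw [inv_pow, ← div_eq_mul_inv, le_div_iff₀ (by positivity)]
    exact (mul_le_mul_of_nonneg_left h1 (norm_nonneg _)).trans h
  -- The roots of `w` have norm `‖y‖ < 1`, so `w` is bounded below on the unit circle and can be
  -- divided out there; a second inversion then gives the coefficients of `p`.
  have hpM : ∀ j < N, ‖p.eval (1 * ζ ^ j)‖ ≤
      N * (N * (M * 2 ^ t) * (‖y‖⁻¹) ^ N) * ((1 - ‖y‖)⁻¹) ^ t := by
    intro j _
    have h1 : ‖(p * w).eval (1 * ζ ^ j)‖ ≤ N * (N * (M * 2 ^ t) * (‖y‖⁻¹) ^ N) := by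
      rw [eval_eq_sum_range' hgdeg]
      refine (norm_sum_le_of_le _ (fun i hi => ?_)).trans_eq
        (by rw [Finset.sum_const, Finset.card_range, nsmul_eq_mul])
      simpa [hζ1] using hgc i (Finset.mem_range.1 hi)
    have h2 : (1 - ‖y‖) ^ t ≤ ‖w.eval (1 * ζ ^ j)‖ := by
      rw [hw, eval_prod, norm_prod, ht, ← Finset.prod_const]
      refine Finset.prod_le_prod (fun _ _ => hy2.le) fun i _ => ?_
      simp only [eval_sub, eval_X, eval_C]
      refine le_trans ?_ (norm_sub_norm_le _ _)
      simp [hζ1]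
    rw [inv_pow (1 - ‖y‖), ← div_eq_mul_inv _ ((1 - ‖y‖) ^ t), le_div_iff₀ (by positivity)]
    rw [eval_mul, norm_mul] at h1
    exact (mul_le_mul_of_nonneg_left h2 (norm_nonneg _)).trans h1
  have h := norm_coeff_mul_pow_le_of_norm_eval_le hζ hN (by omega : p.natDegree < N) 1 hpM k
  simp only [norm_one, one_pow, mul_one] at h
  refine h.trans_eq ?_
  rw [div_eq_mul_inv, mul_pow]
  ring

open MeasureTheory Polynomial in
theorem hasRemezMeasure_of_not_bounded (F : Type*) [NontriviallyNormedField F] [CompleteSpace F]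
    [IsAlgClosed F] (hF : ¬ ∀ n : ℕ, ‖(n : F)‖ ≤ 1) {B : ℝ} (hB : 1 < B) :
    HasRemezMeasure F B := by
  classical
  obtain ⟨f, hfc, hf1, hnat⟩ := exists_complex_ringHom_of_not_bounded F hF
  -- One factor `b ^ n` for each of the three losses: `N ^ 3`, `L ^ T.card` and `‖c‖⁻¹ ^ N`.
  obtain ⟨b, hb1, hbB⟩ := exists_one_lt_pow_le hB 3
  obtain ⟨b2, hb21, hb2b⟩ := exists_one_lt_pow_le hb1 2
  have hb0 : 0 < b := one_pos.trans hb1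
  obtain ⟨c, hc0, hc1⟩ := exists_lt_norm_lt_one_of_isAlgClosed F (r := b2⁻¹)
    (by positivity) (inv_lt_one_of_one_lt₀ hb21)
  have hcpos : 0 < ‖c‖ := lt_trans (by positivity) hc0
  have hcb : (‖c‖⁻¹) ^ 2 ≤ b :=
    (pow_le_pow_left₀ (by positivity) (inv_le_of_inv_le₀ (by positivity) hc0.le) 2).trans hb2b
  set L : ℝ := 2 / (1 - ‖c‖) with hL
  have hL1 : 1 ≤ L := by
    rw [hL, one_le_div (by linarith)]; linarith
  obtain ⟨s, hs⟩ := pow_unbounded_of_one_lt L hb1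
  have hs' : L ≤ b ^ (s + 1) := hs.le.trans (pow_le_pow_right₀ hb1.le s.le_succ)
  obtain ⟨D, hD0, hD⟩ := exists_add_one_pow_le_mul_pow hb1 3
  have hfact : Fact (0 < (1 : ℝ)) := ⟨one_pos⟩
  refine ⟨UnitAddCircle, inferInstance, inferInstance, inferInstance, inferInstance,
    AddCircle.haarAddCircle, inferInstance, fun t => c * f (AddCircle.toCircle t),
    1 / (2 * (s + 1)), 8 * D * b ^ 2, ?_, ?_, by positivity, by positivity, ?_⟩
  · exact continuous_const.mul (hfc.comp (continuous_subtype_val.comp AddCircle.continuous_toCircle))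
  · intro t
    rw [norm_mul, hf1 _ (Circle.norm_coe _), mul_one]
    exact hc1
  intro E hE hμE n p M hp hM0 hM k
  -- The choice of `ε` gives `T.card * (s + 1) ≤ n + 1`, so `N` exceeds `n + T.card`, and `L ≤ b ^
  -- (s + 1)` makes `L ^ T.card ≤ b ^ (n + 1)`.
  set N : ℕ := 2 * (n + 1) with hN
  have hN0 : N ≠ 0 := by omega
  set z : UnitAddCircle := ((1 / N : ℝ) : UnitAddCircle) with hz
  have hprim : IsPrimitiveRoot (f (AddCircle.toCircle z)) N := by
    refine IsPrimitiveRoot.map_of_injective ?_ f.injective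
    have := Complex.isPrimitiveRoot_exp N hN0
    convert this using 1
    rw [hz, AddCircle.toCircle_apply_mk, Circle.coe_exp]
    push_cast
    congr 1
    ring
  obtain ⟨x, hx⟩ := exists_card_filter_notMem_le (AddCircle.haarAddCircle (T := 1))
    (Finset.range N) (fun j t => j • z + t) (fun j _ => measurePreserving_add_left _ _) hE hμE
  set T := (Finset.range N).filter fun j => j • z + x ∉ E with hT
  set y : F := c * f (AddCircle.toCircle x) with hy
  have hynorm : ‖y‖ = ‖c‖ := by rw [hy, norm_mul, hf1 _ (Circle.norm_coe _), mul_one]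
  have hTs : T.card * (s + 1) ≤ n + 1 := by
    have h1 : (T.card : ℝ) * (s + 1) ≤ n + 1 := by
      have : ((1 / (2 * (s + 1)) : NNReal) : ℝ) * ((Finset.range N).card : ℝ)
          = (n + 1) / (s + 1) := by
        rw [Finset.card_range, hN]
        push_cast
        field_simp
      rw [this, le_div_iff₀ (by positivity)] at hx
      exact hx
    exact_mod_cast h1
  have hTn : T.card ≤ n + 1 := (Nat.le_mul_of_pos_right _ s.succ_pos).trans hTs
  have hmain := norm_coeff_le_of_norm_eval_le_off_few hprim (hnat N hN0) (p := p) (y := y)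
    (norm_pos_iff.1 (by rwa [hynorm])) (by rwa [hynorm]) T (by omega) hM0 (fun j hj hjT => ?_) k
  · rw [hynorm, ← hL] at hmain
    refine hmain.trans ?_
    have e1 : L ^ T.card ≤ b ^ (n + 1) := by
      calc L ^ T.card ≤ (b ^ (s + 1)) ^ T.card := by gcongr
        _ = b ^ (T.card * (s + 1)) := by rw [← pow_mul, mul_comm]
        _ ≤ b ^ (n + 1) := pow_le_pow_right₀ hb1.le hTs
    have e2 : (‖c‖⁻¹) ^ N ≤ b ^ (n + 1) := by
      rw [hN, pow_mul]
      gcongr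
    have e3 : (N : ℝ) ^ 3 ≤ 8 * (D * b ^ n) := by
      have : (N : ℝ) ^ 3 = 8 * ((n : ℝ) + 1) ^ 3 := by rw [hN]; push_cast; ring
      rw [this]
      gcongr
      exact hD n
    calc (N : ℝ) ^ 3 * L ^ T.card * (‖c‖⁻¹) ^ N * M
        ≤ (8 * (D * b ^ n)) * b ^ (n + 1) * b ^ (n + 1) * M := by gcongr
      _ = 8 * D * b ^ 2 * (b ^ 3) ^ n * M := by ring
      _ ≤ 8 * D * b ^ 2 * B ^ n * M := by gcongr
  · have hjE : j • z + x ∈ E := by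
      by_contra h
      exact hjT (by simp [hT, hj, h])
    have := hM _ hjE
    simp only [AddCircle.toCircle_add, AddCircle.toCircle_nsmul] at this
    convert this using 3
    push_cast
    rw [map_mul, map_pow, hy]
    ring

/-! ### The nonarchimedean case: residue classes and Gauss norm interpolation -/

theorem norm_sub_le_max_of_isUltrametricDist {F : Type*} [NormedField F] [IsUltrametricDist F] (x y : F) :
    ‖x - y‖ ≤ max ‖x‖ ‖y‖ := by
  simpa [sub_eq_add_neg] using IsUltrametricDist.norm_add_le_max x (-y)

open Polynomial in
/-- In an algebraically closed nonarchimedean field there are infinitely many residue classes. -/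
theorem exists_seq_norm_sub_eq_one (F : Type*) [NormedField F] [IsUltrametricDist F]
    [IsAlgClosed F] : ∃ a : ℕ → F, (∀ i, ‖a i‖ ≤ 1) ∧ ∀ i j, i ≠ j → ‖a i - a j‖ = 1 := by
  classical
  have hsymm : Std.Symm fun x y : F => ‖x - y‖ = 1 := ⟨fun x y h => by rwa [norm_sub_rev]⟩
  suffices h : ∀ s : Finset F, (∀ x ∈ s, ‖x‖ ≤ 1) → ∃ y : F, ‖y‖ ≤ 1 ∧ ∀ x ∈ s, ‖x - y‖ = 1 by
    obtain ⟨a, h1, h2⟩ := exists_seq_of_forall_finset_exists' (fun x : F => ‖x‖ ≤ 1)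
      (fun x y => ‖x - y‖ = 1) h
    exact ⟨a, h1, fun i j hij => h2 hij⟩
  intro s hs
  rcases s.eq_empty_or_nonempty with rfl | hne
  · exact ⟨0, by simp, by simp⟩
  -- The factors `b - x` have product `1` and, once `‖b‖ ≤ 1` is known, norms at most `1`; hence all
  -- have norm `1`.
  obtain ⟨b, hb⟩ := IsAlgClosed.exists_root (∏ x ∈ s, (X - C x) - C 1) (by
    refine degree_ne_of_natDegree_ne ?_
    rw [natDegree_sub_C, natDegree_finsetProd_X_sub_C_eq_card]
    exact hne.card_ne_zero)
  have hprod : ∏ x ∈ s, ‖b - x‖ = 1 := by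
    have : ∏ x ∈ s, (b - x) = 1 := by
      simpa [IsRoot, eval_prod, sub_eq_zero] using hb
    rw [← norm_prod, this, norm_one]
  have hb1 : ‖b‖ ≤ 1 := by
    by_contra! h
    have h3 : ∀ x ∈ s, 1 < ‖b - x‖ := fun x hx => by
      have h4 : ‖b‖ ≤ max ‖b - x‖ ‖x‖ := by
        simpa using IsUltrametricDist.norm_add_le_max (b - x) x
      rcases le_max_iff.1 h4 with h5 | h5
      · linarith
      · linarith [hs x hx]
    have h6 : ∏ _x ∈ s, (1 : ℝ) < ∏ x ∈ s, ‖b - x‖ :=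
      Finset.prod_lt_prod_of_nonempty (fun _ _ => one_pos) h3 hne
    rw [hprod] at h6
    simp at h6
  have hle : ∀ x ∈ s, ‖b - x‖ ≤ 1 := fun x hx =>
    (norm_sub_le_max_of_isUltrametricDist b x).trans (max_le hb1 (hs x hx))
  refine ⟨b, hb1, fun x hx => ?_⟩
  rw [norm_sub_rev]
  refine le_antisymm (hle x hx) ?_
  rw [← hprod, ← Finset.mul_prod_erase s _ hx]
  exact mul_le_of_le_one_right (norm_nonneg _) (Finset.prod_le_one (fun _ _ => norm_nonneg _)
    fun y hy => hle y (Finset.mem_of_mem_erase hy))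

section GaussNorm

open Polynomial

variable {F : Type*} [NormedField F] [IsUltrametricDist F]

theorem isNonarchimedean_toAbsoluteValue : IsNonarchimedean (NormedField.toAbsoluteValue F) :=
  fun x y => IsUltrametricDist.norm_add_le_max x y

variable (F) in
/-- The Gauss norm on polynomials over a nonarchimedean field, as an absolute value. -/
noncomputable def gaussAbsoluteValue : AbsoluteValue F[X] ℝ :=
  have := gaussNorm_isAbsoluteValue (isNonarchimedean_toAbsoluteValue (F := F)) one_pos
  IsAbsoluteValue.toAbsoluteValue (gaussNorm (NormedField.toAbsoluteValue F) 1)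

theorem gaussAbsoluteValue_apply (p : F[X]) :
    gaussAbsoluteValue F p = gaussNorm (NormedField.toAbsoluteValue F) 1 p := rfl

theorem norm_coeff_le_gaussAbsoluteValue (p : F[X]) (k : ℕ) :
    ‖p.coeff k‖ ≤ gaussAbsoluteValue F p := by
  have h := le_gaussNorm (NormedField.toAbsoluteValue F) p zero_le_one k
  rwa [one_pow, mul_one] at h

theorem gaussAbsoluteValue_le {p : F[X]} {M : ℝ} (h : ∀ k, ‖p.coeff k‖ ≤ M) :
    gaussAbsoluteValue F p ≤ M := by
  obtain ⟨i, hi⟩ := exists_eq_gaussNorm (NormedField.toAbsoluteValue F) 1 p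
  rw [gaussAbsoluteValue_apply, hi, one_pow, mul_one]
  exact h i

theorem gaussAbsoluteValue_C (r : F) : gaussAbsoluteValue F (C r) = ‖r‖ :=
  gaussNorm_C _ _ r

theorem gaussAbsoluteValue_X_sub_C {t : F} (ht : ‖t‖ ≤ 1) :
    gaussAbsoluteValue F (X - C t) = 1 := by
  refine le_antisymm (gaussAbsoluteValue_le fun k => ?_) ?_
  · rcases k with _ | _ | k
    · simpa using ht
    · simp
    · simp [coeff_X]
  · have h := norm_coeff_le_gaussAbsoluteValue (X - C t) 1
    rwa [coeff_sub, coeff_X_one, coeff_C_of_ne_zero one_ne_zero, sub_zero, norm_one] at h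

/-- By multiplicativity the numerator of a Lagrange basis polynomial has Gauss norm `1`, so only the
product of node differences counts. -/
theorem gaussAbsoluteValue_le_of_norm_eval_le {ι : Type*} [DecidableEq ι] {S : Finset ι}
    {x : ι → F} (hx : ∀ i ∈ S, ‖x i‖ ≤ 1) {δ : ℝ} (hδ : 0 < δ)
    (hprod : ∀ i ∈ S, δ ≤ ∏ j ∈ S.erase i, ‖x i - x j‖) {g : F[X]} (hg : g.degree < S.card)
    {M : ℝ} (hM0 : 0 ≤ M) (hM : ∀ i ∈ S, ‖g.eval (x i)‖ ≤ M) :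
    gaussAbsoluteValue F g ≤ M / δ := by
  have hinj : Set.InjOn x S := by
    intro i hi j hj hij
    by_contra hne
    have h0 : ∏ j ∈ S.erase i, ‖x i - x j‖ = 0 :=
      Finset.prod_eq_zero (Finset.mem_erase.2 ⟨fun h => hne h.symm, hj⟩) (by simp [hij])
    linarith [hprod i hi]
  refine gaussAbsoluteValue_le fun k => ?_
  rw [Lagrange.eq_interpolate hinj hg, Lagrange.interpolate_apply, finsetSum_coeff]
  refine IsUltrametricDist.norm_sum_le_of_forall_le_of_nonneg (by positivity) fun i hi => ?_
  have hbasis : gaussAbsoluteValue F (Lagrange.basis S x i) ≤ δ⁻¹ := by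
    rw [Lagrange.basis, map_prod]
    have : ∀ j ∈ S.erase i, gaussAbsoluteValue F (Lagrange.basisDivisor (x i) (x j)) =
        ‖x i - x j‖⁻¹ := fun j hj => by
      rw [Lagrange.basisDivisor, map_mul, gaussAbsoluteValue_C,
        gaussAbsoluteValue_X_sub_C (hx j (Finset.mem_of_mem_erase hj)), mul_one, norm_inv]
    rw [Finset.prod_congr rfl this, Finset.prod_inv_distrib]
    exact inv_anti₀ hδ (hprod i hi)
  rw [coeff_C_mul, norm_mul, div_eq_mul_inv]
  exact mul_le_mul (hM i hi) ((norm_coeff_le_gaussAbsoluteValue _ k).trans hbasis)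
    (norm_nonneg _) hM0

/-- Killing the bad nodes is free, since `w` has Gauss norm `1`. Interpolating `p ^ k` in place of
`p` reduces the loss `1 / δ` to its `k`-th root. -/
theorem gaussAbsoluteValue_pow_le_of_norm_eval_le_off_few {ι : Type*} [DecidableEq ι]
    {S T : Finset ι} {x : ι → F} (hx : ∀ i ∈ S, ‖x i‖ ≤ 1) {δ : ℝ} (hδ : 0 < δ)
    (hprod : ∀ i ∈ S, δ ≤ ∏ j ∈ S.erase i, ‖x i - x j‖) (hTS : T ⊆ S) {p : F[X]} {k : ℕ}
    (hdeg : k * p.natDegree + T.card < S.card) {M : ℝ} (hM0 : 0 ≤ M)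
    (hM : ∀ i ∈ S, i ∉ T → ‖p.eval (x i)‖ ≤ M) :
    gaussAbsoluteValue F p ^ k ≤ M ^ k / δ := by
  set w : F[X] := ∏ i ∈ T, (X - C (x i)) with hw
  have hwG : gaussAbsoluteValue F w = 1 := by
    rw [hw, map_prod]
    exact Finset.prod_eq_one fun i hi => gaussAbsoluteValue_X_sub_C (hx i (hTS hi))
  have hwdeg : w.natDegree = T.card := natDegree_finsetProd_X_sub_C_eq_card ..
  have h : gaussAbsoluteValue F (p ^ k * w) ≤ M ^ k / δ := by
    refine gaussAbsoluteValue_le_of_norm_eval_le hx hδ hprod ?_ (by positivity) fun i hi => ?_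
    · refine degree_le_natDegree.trans_lt (Nat.cast_lt.2 (natDegree_mul_le.trans_lt ?_))
      rw [hwdeg]
      exact (Nat.add_le_add_right natDegree_pow_le _).trans_lt hdeg
    · rw [eval_mul, norm_mul, eval_pow, norm_pow]
      by_cases hiT : i ∈ T
      · have : w.eval (x i) = 0 := by
          rw [hw, eval_prod]
          exact Finset.prod_eq_zero hiT (by simp)
        rw [this, norm_zero, mul_zero]
        positivity
      · have h1 : ‖w.eval (x i)‖ ≤ 1 := by
          rw [hw, eval_prod, norm_prod]
          refine Finset.prod_le_one (fun _ _ => norm_nonneg _) fun j hj => ?_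
          simp only [eval_sub, eval_X, eval_C]
          exact (norm_sub_le_max_of_isUltrametricDist _ _).trans (max_le (hx i hi) (hx j (hTS hj)))
        exact (mul_le_of_le_one_right (by positivity) h1).trans
          (pow_le_pow_left₀ (norm_nonneg _) (hM i hi hiT) k)
  rwa [map_mul, map_pow, hwG, mul_one] at h

end GaussNorm

/-! ### Digit expansions as interpolation nodes -/

section Digits

/-- Prepend a digit to a digit sequence. -/
def consDigit {G : Type*} (g : G) (w : ℕ → G) : ℕ → G
  | 0 => g
  | k + 1 => w k

theorem consDigit_injective {G : Type*} :
    Function.Injective fun gw : G × (ℕ → G) => consDigit gw.1 gw.2 := by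
  rintro ⟨g, w⟩ ⟨g', w'⟩ h
  have h0 : g = g' := congrFun h 0
  have h1 : w = w' := funext fun k => congrFun h (k + 1)
  rw [h0, h1]

theorem consDigit_eq_iff {G : Type*} {g g' : G} {w w' : ℕ → G} :
    consDigit g w = consDigit g' w' ↔ g = g' ∧ w = w' :=
  ⟨fun h => Prod.ext_iff.1 (consDigit_injective (a₁ := (g, w)) (a₂ := (g', w')) h),
    fun h => by rw [h.1, h.2]⟩

open Classical in
/-- The digit sequences vanishing from index `m` on. -/
noncomputable def digitWords (G : Type*) [Fintype G] [Zero G] : ℕ → Finset (ℕ → G)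
  | 0 => {0}
  | m + 1 => (Finset.univ ×ˢ digitWords G m).image fun gw => consDigit gw.1 gw.2

theorem card_digitWords (G : Type*) [Fintype G] [Zero G] (m : ℕ) :
    (digitWords G m).card = Fintype.card G ^ m := by
  classical
  induction m with
  | zero => simp [digitWords]
  | succ m ih =>
    rw [digitWords, Finset.card_image_of_injective _ consDigit_injective, Finset.card_product,
      ih, Finset.card_univ, pow_succ']

variable {F G : Type*} [NormedField F]

/-- The value of a digit sequence in base `π` with digits `a`. -/
noncomputable def digitSum (a : G → F) (π : F) (ω : ℕ → G) : F := ∑' k, a (ω k) * π ^ k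

variable {a : G → F} {π : F}

theorem norm_digit_mul_pow_le (ha : ∀ g, ‖a g‖ ≤ 1) (ω : ℕ → G) (k : ℕ) : ‖a (ω k) * π ^ k‖ ≤ ‖π‖ ^ k := by
  rw [norm_mul, norm_pow]
  exact mul_le_of_le_one_left (by positivity) (ha _)

theorem continuous_digitSum [CompleteSpace F] [TopologicalSpace G] [DiscreteTopology G]
    (ha : ∀ g, ‖a g‖ ≤ 1) (hπ : ‖π‖ < 1) :
    Continuous (digitSum a π) :=
  continuous_tsum (fun k => ((continuous_of_discreteTopology (f := a)).comp
      (continuous_apply k)).mul continuous_const)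
    (summable_geometric_of_lt_one (norm_nonneg π) hπ)
    fun k ω => norm_digit_mul_pow_le ha ω k

theorem digitSum_eq [CompleteSpace F] (ha : ∀ g, ‖a g‖ ≤ 1) (hπ : ‖π‖ < 1)
    (ω : ℕ → G) :
    digitSum a π ω = a (ω 0) + π * digitSum a π fun k => ω (k + 1) := by
  have hs : Summable fun k => a (ω k) * π ^ k :=
    Summable.of_norm_bounded (summable_geometric_of_lt_one (norm_nonneg π) hπ)
      fun k => norm_digit_mul_pow_le ha ω k
  rw [digitSum, hs.tsum_eq_zero_add, digitSum, ← tsum_mul_left]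
  simp only [pow_zero, mul_one, pow_succ]
  congr 1
  exact tsum_congr fun k => by ring

variable [IsUltrametricDist F]

theorem norm_digitSum_le (ha : ∀ g, ‖a g‖ ≤ 1) (hπ : ‖π‖ < 1) (ω : ℕ → G) : ‖digitSum a π ω‖ ≤ 1 :=
  IsUltrametricDist.norm_tsum_le_of_forall_le_of_nonneg zero_le_one fun k =>
    (norm_digit_mul_pow_le ha ω k).trans (pow_le_one₀ (norm_nonneg π) hπ.le)

/-- The leading digits differ by norm `1`, and the tails by less. -/
theorem one_le_norm_digitSum_sub [CompleteSpace F] (ha : ∀ g, ‖a g‖ ≤ 1) (hπ : ‖π‖ < 1)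
    (hd : ∀ g g', g ≠ g' → ‖a g - a g'‖ = 1)
    {ω ω' : ℕ → G} (h : ω 0 ≠ ω' 0) : 1 ≤ ‖digitSum a π ω - digitSum a π ω'‖ := by
  set u := digitSum a π fun k => ω (k + 1) with hu
  set u' := digitSum a π fun k => ω' (k + 1) with hu'
  have h1 : ‖u - u'‖ ≤ 1 := (norm_sub_le_max_of_isUltrametricDist _ _).trans
    (max_le (norm_digitSum_le ha hπ _) (norm_digitSum_le ha hπ _))
  have h2 : a (ω 0) - a (ω' 0) = (digitSum a π ω - digitSum a π ω') - π * (u - u') := by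
    rw [digitSum_eq ha hπ ω, digitSum_eq ha hπ ω']; ring
  have h3 : ‖π * (u - u')‖ < 1 := by
    rw [norm_mul]
    exact (mul_le_of_le_one_right (norm_nonneg _) h1).trans_lt hπ
  have h4 := norm_sub_le_max_of_isUltrametricDist (digitSum a π ω - digitSum a π ω') (π * (u - u'))
  rw [← h2, hd _ _ h] at h4
  exact (le_max_iff.1 h4).resolve_right h3.not_ge

-- Words with another first digit contribute factors at least `1`; those with the same first digit
-- contribute `‖π‖` times the difference of the shifted words. The shift also moves `x`, so the
-- induction runs over all `x`. Addition of words is digitwise and unrelated to addition in `F`: it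
-- only has to preserve where two words first differ.
open Classical in
theorem pow_le_prod_norm_digitSum_sub [CompleteSpace F] [Fintype G] [AddGroup G]
    (ha : ∀ g, ‖a g‖ ≤ 1) (hπ : ‖π‖ < 1)
    (hd : ∀ g g', g ≠ g' → ‖a g - a g'‖ = 1) (m : ℕ) :
    ∀ x : ℕ → G, ∀ w ∈ digitWords G m, ‖π‖ ^ (∑ i ∈ Finset.range m, Fintype.card G ^ i) ≤
      ∏ v ∈ digitWords G m,
        if v = w then 1 else ‖digitSum a π (w + x) - digitSum a π (v + x)‖ := by
  induction m with
  | zero => intro x w hw; simp_all [digitWords]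
  | succ m ih =>
    intro x w hw
    obtain ⟨⟨g, w⟩, hgw, rfl⟩ := Finset.mem_image.1 hw
    have hw' : w ∈ digitWords G m := (Finset.mem_product.1 hgw).2
    rw [digitWords, Finset.prod_image consDigit_injective.injOn, Finset.prod_product]
    have hge : ∀ g' ∈ Finset.univ, g' ≠ g → 1 ≤ ∏ v ∈ digitWords G m,
        (if consDigit g' v = consDigit g w then 1 else
          ‖digitSum a π (consDigit g w + x) - digitSum a π (consDigit g' v + x)‖) := by
      intro g' _ hg'
      refine Finset.prod_induction _ (fun r : ℝ => 1 ≤ r) (fun _ _ => one_le_mul_of_one_le_of_one_le)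
        le_rfl fun v _ => ?_
      rw [if_neg fun h => hg' (consDigit_eq_iff.1 h).1]
      refine one_le_norm_digitSum_sub ha hπ hd ?_
      simpa [consDigit] using hg'.symm
    have heq : ∏ v ∈ digitWords G m, (if consDigit g v = consDigit g w then (1 : ℝ) else
          ‖digitSum a π (consDigit g w + x) - digitSum a π (consDigit g v + x)‖) =
        ∏ v ∈ digitWords G m, (if v = w then 1 else
          ‖π‖ * ‖digitSum a π (w + fun k => x (k + 1)) - digitSum a π (v + fun k => x (k + 1))‖) := by
      refine Finset.prod_congr rfl fun v _ => ?_
      by_cases hvw : v = w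
      · simp [hvw]
      · rw [if_neg hvw, if_neg fun h => hvw (consDigit_eq_iff.1 h).2,
          digitSum_eq ha hπ, digitSum_eq ha hπ (consDigit g v + x), ← norm_mul]
        congr 1
        have e : ∀ u : ℕ → G, (fun k => (consDigit g u + x) (k + 1)) = u + fun k => x (k + 1) :=
          fun u => rfl
        rw [e, e]
        simp only [Pi.add_apply, consDigit]
        ring
    calc ‖π‖ ^ (∑ i ∈ Finset.range (m + 1), Fintype.card G ^ i)
        = ‖π‖ ^ (digitWords G m).card * ‖π‖ ^ (∑ i ∈ Finset.range m, Fintype.card G ^ i) := by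
          rw [Finset.sum_range_succ, pow_add, card_digitWords, mul_comm]
      _ ≤ (∏ _v ∈ digitWords G m, ‖π‖) * ∏ v ∈ digitWords G m, (if v = w then 1 else
          ‖digitSum a π (w + fun k => x (k + 1)) - digitSum a π (v + fun k => x (k + 1))‖) := by
          rw [Finset.prod_const]
          exact mul_le_mul_of_nonneg_left (ih _ w hw') (by positivity)
      _ ≤ ∏ v ∈ digitWords G m, (if v = w then 1 else
          ‖π‖ * ‖digitSum a π (w + fun k => x (k + 1)) -
            digitSum a π (v + fun k => x (k + 1))‖) := by
          rw [← Finset.prod_mul_distrib]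
          refine Finset.prod_le_prod (fun v _ => ?_) fun v _ => ?_ <;> split_ifs <;>
            first | positivity | simp [hπ.le]
      _ = _ := heq.symm
      _ ≤ _ := by
          rw [← Finset.mul_prod_erase _ _ (Finset.mem_univ g)]
          refine le_mul_of_one_le_right (Finset.prod_nonneg fun v _ => by split_ifs <;> positivity) ?_
          exact Finset.prod_induction _ (fun r : ℝ => 1 ≤ r)
            (fun _ _ => one_le_mul_of_one_le_of_one_le) le_rfl
            fun g' hg' => hge g' (Finset.mem_univ _) (Finset.ne_of_mem_erase hg')

end Digits

/-! ### The Remez measure in the nonarchimedean case -/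

open MeasureTheory Polynomial in
theorem hasRemezMeasure_of_isUltrametricDist (F : Type*) [NontriviallyNormedField F]
    [CompleteSpace F] [IsAlgClosed F] [IsUltrametricDist F] {B : ℝ} (hB : 1 < B) :
    HasRemezMeasure F B := by
  classical
  obtain ⟨b, hb1, hbB⟩ := exists_one_lt_pow_le hB 2
  have hb0 : 0 < b := one_pos.trans hb1
  obtain ⟨π, hπ0, hπ1⟩ := NormedField.exists_norm_lt_one F
  obtain ⟨c, hc0, hc1⟩ := exists_lt_norm_lt_one_of_isAlgClosed F (r := b⁻¹)
    (by positivity) (inv_lt_one_of_one_lt₀ hb1)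
  have hcpos : 0 < ‖c‖ := lt_trans (by positivity) hc0
  have hcb : ‖c‖⁻¹ ≤ b := inv_le_of_inv_le₀ (by positivity) hc0.le
  obtain ⟨s₀, hs₀⟩ := pow_unbounded_of_one_lt (‖π‖⁻¹) hb1
  obtain ⟨s, hs⟩ : ∃ s, s = s₀ + 1 := ⟨_, rfl⟩
  have hsb : ‖π‖⁻¹ ≤ b ^ s := hs₀.le.trans (pow_le_pow_right₀ hb1.le (by omega))
  obtain ⟨a', ha', hd'⟩ := exists_seq_norm_sub_eq_one F
  -- With `4 * s + 1` digits the exponent `e` of the loss is below `W.card / (4 * s)`, so `‖π‖⁻¹ ≤ b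
  -- ^ s` bounds the loss by `b ^ (W.card / 4)`.
  set G := Fin (4 * s + 1)
  have hcard : Fintype.card G = 4 * s + 1 := Fintype.card_fin _
  set a : G → F := fun g => a' g
  have ha : ∀ g, ‖a g‖ ≤ 1 := fun g => ha' g
  have hd : ∀ g g', g ≠ g' → ‖a g - a g'‖ = 1 := fun g g' h => hd' _ _ fun h' => h (Fin.ext h')
  let _ : MeasurableSpace (ℕ → G) := borel (ℕ → G)
  have _ : BorelSpace (ℕ → G) := ⟨rfl⟩
  let μ : Measure (ℕ → G) := Measure.addHaarMeasure ⊤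
  have hμprob : IsProbabilityMeasure μ := ⟨by
    simpa using Measure.addHaarMeasure_self (K₀ := (⊤ : TopologicalSpace.PositiveCompacts (ℕ → G)))⟩
  refine ⟨ℕ → G, inferInstance, inferInstance, inferInstance, inferInstance, μ, hμprob,
    fun ω => c * digitSum a π ω, 1 / 4, b, continuous_const.mul (continuous_digitSum ha hπ1),
    fun ω => ?_, by positivity, hb0, ?_⟩
  · rw [norm_mul]
    exact (mul_le_of_le_one_right (norm_nonneg _) (norm_digitSum_le ha hπ1 ω)).trans_lt hc1
  intro E hE hμE n p M hp hM0 hM j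
  set m := 4 * (n + 1) with hm
  set W := digitWords G m with hW
  have hWcard : W.card = (4 * s + 1) ^ m := by rw [hW, card_digitWords, hcard]
  have hWm : m < W.card := by
    rw [hWcard]
    exact Nat.lt_pow_self (by omega)
  obtain ⟨x, hx⟩ := exists_card_filter_notMem_le μ W (fun w t => w + t)
    (fun w _ => measurePreserving_add_left _ _) hE hμE
  set T := W.filter fun w => w + x ∉ E with hT
  have hT4 : T.card * 4 ≤ W.card := by
    have : (T.card : ℝ) * 4 ≤ W.card := by
      simp at hx
      linarith
    exact_mod_cast this
  -- `p ^ k` uses at most half of the nodes and the bad ones at most a quarter, while the `k`-th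
  -- root of the loss is at most `b ^ (n + 1)`.
  set k := W.card / (2 * (n + 1)) with hk
  have hk1 : k * (2 * (n + 1)) ≤ W.card := Nat.div_mul_le_self _ _
  have hk2 : W.card < (k + 1) * (2 * (n + 1)) := by
    rw [mul_comm]; exact Nat.lt_mul_div_succ _ (by omega)
  have hk3 : 2 ≤ k := by
    rw [hk, Nat.le_div_iff_mul_le (by omega)]
    omega
  set e := ∑ i ∈ Finset.range m, (4 * s + 1) ^ i with he
  have hse : s * e ≤ k * (n + 1) := by
    have h1 : e * (4 * s) + 1 = W.card := by
      rw [he, hWcard]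
      have h2 := geom_sum_mul_add (4 * s) m
      simpa using h2
    have h3 : (k + 1) * (2 * (n + 1)) ≤ (2 * k) * (2 * (n + 1)) :=
      Nat.mul_le_mul_right _ (by omega)
    nlinarith
  -- Digit sums may have norm `1`; scaling by `c` moves them into the open disc and costs another `b
  -- ^ n`.
  set P : F[X] := p.comp (C c * X) with hP
  have hPdeg : P.natDegree ≤ n := by
    refine natDegree_comp_le.trans ?_
    calc p.natDegree * (C c * X : F[X]).natDegree ≤ n * 1 :=
          Nat.mul_le_mul hp ((natDegree_C_mul_le _ _).trans natDegree_X_le)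
      _ = n := mul_one n
  have hδ : 0 < ‖π‖ ^ e := by positivity
  have hmain := gaussAbsoluteValue_pow_le_of_norm_eval_le_off_few (S := W) (T := T)
    (x := fun w => digitSum a π (w + x)) (fun w _ => norm_digitSum_le ha hπ1 _) hδ
    (fun w hw => ?_) (Finset.filter_subset _ _) (p := P) (k := k) ?_ hM0 (fun w hw hwT => ?_)
  · have h1 : (‖π‖ ^ e)⁻¹ ≤ (b ^ (n + 1)) ^ k := by
      calc (‖π‖ ^ e)⁻¹ = (‖π‖⁻¹) ^ e := (inv_pow _ _).symm
        _ ≤ (b ^ s) ^ e := by gcongr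
        _ = b ^ (s * e) := (pow_mul _ _ _).symm
        _ ≤ b ^ (k * (n + 1)) := pow_le_pow_right₀ hb1.le hse
        _ = (b ^ (n + 1)) ^ k := by rw [← pow_mul, mul_comm]
    have h2 : gaussAbsoluteValue F P ^ k ≤ (M * b ^ (n + 1)) ^ k := by
      rw [mul_pow]
      rw [div_eq_mul_inv] at hmain
      exact hmain.trans (mul_le_mul_of_nonneg_left h1 (by positivity))
    have h3 : gaussAbsoluteValue F P ≤ M * b ^ (n + 1) :=
      le_of_pow_le_pow_left₀ (by omega) (by positivity) h2
    have h4 := (norm_coeff_le_gaussAbsoluteValue P j).trans h3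
    rw [hP, comp_C_mul_X_coeff, norm_mul, norm_pow] at h4
    rcases le_or_gt j n with hj | hj
    · calc ‖p.coeff j‖ = ‖p.coeff j‖ * ‖c‖ ^ j * (‖c‖⁻¹) ^ j := by
            rw [mul_assoc, ← mul_pow, mul_inv_cancel₀ hcpos.ne', one_pow, mul_one]
        _ ≤ M * b ^ (n + 1) * b ^ n := by
            refine mul_le_mul h4 ?_ (by positivity) (by positivity)
            exact (pow_le_pow_left₀ (by positivity) hcb j).trans (pow_le_pow_right₀ hb1.le hj)
        _ = b * (b ^ 2) ^ n * M := by ring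
        _ ≤ b * B ^ n * M := by gcongr
    · rw [coeff_eq_zero_of_natDegree_lt (hp.trans_lt hj), norm_zero]
      positivity
  · have h := pow_le_prod_norm_digitSum_sub ha hπ1 hd m x w hw
    rw [← hW, ← Finset.mul_prod_erase W _ hw, if_pos rfl, one_mul] at h
    rw [hcard] at h
    refine h.trans_eq (Finset.prod_congr rfl fun v hv => ?_)
    rw [if_neg (Finset.ne_of_mem_erase hv)]
  · have h1 : k * P.natDegree ≤ k * n := Nat.mul_le_mul_left _ hPdeg
    nlinarith
  · have hwE : w + x ∈ E := by
      by_contra h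
      exact hwT (by simp [hT, hw, h])
    have := hM _ hwE
    simpa [hP, eval_comp] using this

/-! ### From one variable to several, by Fubini -/

open MeasureTheory in
/-- If the complement of `E` has small measure for `μ × ν`, then most sections of `E` along the
first factor have small complement. -/
theorem measure_measure_section_lt {α β : Type*} [MeasurableSpace α] [MeasurableSpace β]
    (μ : Measure α) (ν : Measure β) [SFinite μ] [SFinite ν] {S : Set (α × β)}
    (hS : MeasurableSet S) {ε : NNReal} {δ : ENNReal}
    (h : μ.prod ν S < ε * δ) :
    MeasurableSet {y | μ ((fun x => (x, y)) ⁻¹' S) ≤ ε} ∧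
      ν {y | μ ((fun x => (x, y)) ⁻¹' S) ≤ ε}ᶜ < δ := by
  have hm : Measurable fun y => μ ((fun x => (x, y)) ⁻¹' S) := measurable_measure_prodMk_right hS
  refine ⟨measurableSet_le hm measurable_const, ?_⟩
  rw [Measure.prod_apply_symm hS] at h
  have h1 : (ε : ENNReal) * ν {y | (ε : ENNReal) ≤ μ ((fun x => (x, y)) ⁻¹' S)} < ε * δ :=
    (mul_meas_ge_le_lintegral hm ε).trans_lt h
  have h2 : ν {y | μ ((fun x => (x, y)) ⁻¹' S) ≤ ε}ᶜ ≤
      ν {y | (ε : ENNReal) ≤ μ ((fun x => (x, y)) ⁻¹' S)} :=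
    measure_mono fun y hy => (not_le.1 (show ¬ μ _ ≤ ε from hy)).le
  exact h2.trans_lt (lt_of_mul_lt_mul_left' h1)

-- For most values of the last `d` variables the section in the first is large enough for `H`, which
-- bounds the coefficients of `h` as a polynomial in the first variable; these are polynomials in
-- the others, to which induction applies. For `d = 0` the strict bound by `ε ^ 0 = 1` says that `E`
-- is nonempty.
open MeasureTheory Polynomial in
theorem norm_coeff_le_of_norm_eval_le_of_measure_pi_lt {F Ω : Type*} [NormedField F]
    [MeasurableSpace Ω] (μ : Measure Ω) [IsProbabilityMeasure μ] {φ : Ω → F} {ε : NNReal}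
    {a : ℝ} (ha : 0 ≤ a) {n : ℕ}
    (H : ∀ E : Set Ω, MeasurableSet E → μ Eᶜ ≤ ε → ∀ (p : F[X]) (M : ℝ),
      p.natDegree ≤ n → 0 ≤ M → (∀ ω ∈ E, ‖p.eval (φ ω)‖ ≤ M) → ∀ k, ‖p.coeff k‖ ≤ a * M)
    (d : ℕ) : ∀ E : Set (Fin d → Ω), MeasurableSet E →
      Measure.pi (fun _ => μ) Eᶜ < (ε : ENNReal) ^ d → ∀ (h : MvPolynomial (Fin d) F) (M : ℝ),
      h.totalDegree ≤ n → 0 ≤ M → (∀ ω ∈ E, ‖MvPolynomial.eval (fun j => φ (ω j)) h‖ ≤ M) →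
      ∀ m, ‖h.coeff m‖ ≤ a ^ d * M := by
  induction d with
  | zero =>
    intro E hE hμ h M _ _ hM m
    obtain ⟨ω, hω⟩ : E.Nonempty := by
      by_contra hne
      rw [Set.not_nonempty_iff_eq_empty.1 hne] at hμ
      simp at hμ
    have h1 := hM ω hω
    rw [MvPolynomial.eq_C_of_isEmpty h] at h1 ⊢
    rw [Subsingleton.elim m 0]
    simpa using h1
  | succ d ih =>
    intro E hE hμ h M hh hM0 hM m
    set e := MeasurableEquiv.piFinSuccAbove (fun _ : Fin (d + 1) => Ω) 0
    have hep : MeasurePreserving e (Measure.pi fun _ => μ) (μ.prod (Measure.pi fun _ => μ)) :=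
      measurePreserving_piFinSuccAbove (fun _ => μ) 0
    have hcons : ∀ y x, e.symm (y, x) = Fin.cons y x := fun y x => by
      rw [← Fin.insertNth_zero']; rfl
    have hS : MeasurableSet (e.symm ⁻¹' Eᶜ) := e.symm.measurable hE.compl
    have hSμ : μ.prod (Measure.pi fun _ => μ) (e.symm ⁻¹' Eᶜ) < ε * (ε : ENNReal) ^ d := by
      rw [hep.symm.measure_preimage_equiv, ← pow_succ']
      exact hμ
    obtain ⟨hE'm, hE'⟩ := measure_measure_section_lt μ _ hS hSμ
    have key : ∀ k m, ‖((MvPolynomial.finSuccEquiv F d h).coeff k).coeff m‖ ≤ a ^ d * (a * M) := by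
      intro k
      by_cases hk0 : (MvPolynomial.finSuccEquiv F d h).coeff k = 0
      · intro m
        rw [hk0, MvPolynomial.coeff_zero, norm_zero]
        positivity
      refine ih _ hE'm hE' _ _ ?_ (by positivity) fun x hx => ?_
      · have := MvPolynomial.totalDegree_coeff_finSuccEquiv_add_le h k hk0
        omega
      have hxm : MeasurableSet {y | (Fin.cons y x : Fin (d + 1) → Ω) ∈ E} := by
        have : Measurable fun y => e.symm (y, x) := e.symm.measurable.comp measurable_prodMk_right
        simp only [hcons] at this
        exact this hE
      have h1 := H {y | (Fin.cons y x : Fin (d + 1) → Ω) ∈ E} hxm (by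
        refine le_trans (measure_mono fun y hy => ?_) hx
        simpa [hcons] using hy)
        (Polynomial.map (MvPolynomial.eval fun j => φ (x j)) (MvPolynomial.finSuccEquiv F d h)) M
        (natDegree_map_le.trans (by
          rw [MvPolynomial.natDegree_finSuccEquiv]
          exact (MvPolynomial.degreeOf_le_totalDegree h 0).trans hh)) hM0 (fun y hy => ?_) k
      · rwa [coeff_map] at h1
      · rw [← MvPolynomial.eval_eq_eval_mv_eval']
        have hc : (Fin.cons (φ y) fun j => φ (x j) : Fin (d + 1) → F) =
            fun j => φ ((Fin.cons y x : Fin (d + 1) → Ω) j) := by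
          funext j
          refine Fin.cases ?_ (fun j => ?_) j <;> simp
        rw [hc]
        exact hM _ hy
    have h2 := key (m 0) m.tail
    rw [MvPolynomial.finSuccEquiv_coeff_coeff, Finsupp.cons_tail] at h2
    exact h2.trans_eq (by ring)

theorem card_support_le_totalDegree_add_one_pow {R : Type*} [CommSemiring R] {d : ℕ}
    (h : MvPolynomial (Fin d) R) : h.support.card ≤ (h.totalDegree + 1) ^ d := by
  have h1 : h.support.card ≤
      (Fintype.piFinset fun _ : Fin d => Finset.range (h.totalDegree + 1)).card := by
    refine Finset.card_le_card_of_injOn (fun m => (m : Fin d → ℕ)) (fun m hm => ?_)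
      DFunLike.coe_injective.injOn
    refine Fintype.mem_piFinset.2 fun j => Finset.mem_range.2 (Nat.lt_succ_of_le ?_)
    exact (MvPolynomial.le_degreeOf_of_mem_support j hm).trans
      (MvPolynomial.degreeOf_le_totalDegree h j)
  simpa using h1

theorem coeffNorm_nonneg {F : Type*} [NormedField F] {d : ℕ} (h : MvPolynomial (Fin d) F) :
    0 ≤ coeffNorm h :=
  Finset.sum_nonneg fun _ _ => norm_nonneg _

theorem norm_eval_le_supNormOn {F : Type*} [NormedField F] {d : ℕ} {X : Set (Fin d → F)}
    (hX : X ⊆ openUnitPolydisk F d) (h : MvPolynomial (Fin d) F) {x : Fin d → F} (hx : x ∈ X) :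
    ‖MvPolynomial.eval x h‖ ≤ supNormOn X h :=
  le_ciSup (f := fun x : X => ‖MvPolynomial.eval (x : Fin d → F) h‖)
    ⟨coeffNorm h, by rintro _ ⟨y, rfl⟩; exact norm_eval_le_coeffNorm h (hX y.2)⟩ ⟨x, hx⟩

theorem supNormOn_nonneg {F : Type*} [NormedField F] {d : ℕ} (X : Set (Fin d → F))
    (h : MvPolynomial (Fin d) F) : 0 ≤ supNormOn X h :=
  Real.iSup_nonneg fun _ => norm_nonneg _

open MeasureTheory in
theorem eventually_exists_coeffNorm_le {F : Type*} [NormedField F]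
    (hF : ∀ b : ℝ, 1 < b → HasRemezMeasure F b) {d : ℕ} {X : ℕ → Set (Fin d → F)}
    (hmono : Monotone X) (hclosed : ∀ i, IsClosed ((↑) ⁻¹' X i : Set (openUnitPolydisk F d)))
    (hunion : (⋃ i, X i) = openUnitPolydisk F d) {B : ℝ} (hB : 1 < B) :
    ∀ᶠ i in atTop, ∃ A : ℝ, 0 < A ∧ ∀ h : MvPolynomial (Fin d) F,
      coeffNorm h ≤ A * B ^ h.totalDegree * supNormOn (X i) h := by
  -- One factor `b ^ n` per variable and one for the number of monomials.
  obtain ⟨b, hb1, hbB⟩ := exists_one_lt_pow_le hB (d + 1)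
  have hb0 : 0 < b := one_pos.trans hb1
  obtain ⟨C, hC0, hC⟩ := exists_add_one_pow_le_mul_pow hb1 d
  obtain ⟨Ω, _, _, _, _, μ, _, φ, ε, A, hφ, hφ1, hε, hA, H⟩ := hF b hb1
  have hXsub : ∀ i, X i ⊆ openUnitPolydisk F d := fun i => hunion ▸ Set.subset_iUnion X i
  let Φ : (Fin d → Ω) → openUnitPolydisk F d := fun ω => ⟨fun j => φ (ω j), fun j => hφ1 (ω j)⟩
  have hΦ : Continuous Φ :=
    Continuous.subtype_mk (continuous_pi fun j => hφ.comp (continuous_apply j)) _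
  let E : ℕ → Set (Fin d → Ω) := fun i => Φ ⁻¹' ((↑) ⁻¹' X i)
  have hE : ∀ i, MeasurableSet (E i) := fun i => ((hclosed i).preimage hΦ).measurableSet
  have hlim : Tendsto (fun i => Measure.pi (fun _ => μ) (E i)ᶜ) atTop (𝓝 0) := by
    have h0 : (⋂ i, (E i)ᶜ) = ∅ := by
      rw [← Set.compl_iUnion, Set.compl_empty_iff, Set.eq_univ_iff_forall]
      intro ω
      have : (Φ ω : Fin d → F) ∈ ⋃ i, X i := by
        rw [hunion]; exact (Φ ω).2
      obtain ⟨i, hi⟩ := Set.mem_iUnion.1 this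
      exact Set.mem_iUnion.2 ⟨i, hi⟩
    have := tendsto_measure_iInter_atTop (μ := Measure.pi fun _ : Fin d => μ)
      (s := fun i => (E i)ᶜ) (fun i => (hE i).compl.nullMeasurableSet)
      (fun i j hij => Set.compl_subset_compl.2 fun ω hω => hmono hij hω)
      ⟨0, measure_ne_top _ _⟩
    rwa [h0, measure_empty] at this
  have hpos : (0 : ENNReal) < (ε : ENNReal) ^ d :=
    ENNReal.pow_pos (ENNReal.coe_pos.2 hε) d
  filter_upwards [hlim.eventually_lt_const hpos] with i hi
  refine ⟨C * A ^ d, by positivity, fun h => ?_⟩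
  set n := h.totalDegree with hn
  have hM0 := supNormOn_nonneg (X i) h
  have hcoeff := norm_coeff_le_of_norm_eval_le_of_measure_pi_lt μ (a := A * b ^ n)
    (by positivity) (fun E hE hμ p M hp => H E hE hμ n p M hp) d (E i) (hE i) hi h
    (supNormOn (X i) h) le_rfl hM0 fun ω hω => norm_eval_le_supNormOn (hXsub i) h hω
  calc coeffNorm h ≤ h.support.card • ((A * b ^ n) ^ d * supNormOn (X i) h) :=
        Finset.sum_le_card_nsmul _ _ _ fun m _ => hcoeff m
    _ ≤ (C * b ^ n) * ((A * b ^ n) ^ d * supNormOn (X i) h) := by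
        rw [nsmul_eq_mul]
        refine mul_le_mul_of_nonneg_right (le_trans ?_ (hC n)) (by positivity)
        exact_mod_cast card_support_le_totalDegree_add_one_pow h
    _ = C * A ^ d * (b ^ (d + 1)) ^ n * supNormOn (X i) h := by
        rw [mul_pow, ← pow_mul, ← pow_mul, add_one_mul, pow_add, mul_comm d n]; ring
    _ ≤ C * A ^ d * B ^ n * supNormOn (X i) h := by gcongr

/-! ### The diagonal choice of `B i` -/

theorem exists_tendsto_atTop_of_forall_eventually {Q : ℕ → ℕ → Prop}
    (hQ : ∀ k, ∀ᶠ i in atTop, Q k i) :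
    ∃ K : ℕ → ℕ, Tendsto K atTop atTop ∧ ∀ᶠ i in atTop, Q (K i) i := by
  classical
  refine ⟨fun i => Nat.findGreatest (fun k => Q k i) i, tendsto_atTop.2 fun k => ?_, ?_⟩
  · filter_upwards [hQ k, eventually_ge_atTop k] with i h1 h2
    exact Nat.le_findGreatest h2 h1
  -- `Nat.findGreatest` defaults to `0` when no `k ≤ i` works, so `Q 0 i` is needed.
  · filter_upwards [hQ 0] with i h
    exact Nat.findGreatest_spec (P := fun k => Q k i) i.zero_le h

theorem perfectInterpolationProperty_of_hasRemezMeasure {F : Type*} [NormedField F]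
    (hF : ∀ b : ℝ, 1 < b → HasRemezMeasure F b) : PerfectInterpolationProperty F := by
  classical
  intro d X hmono hclosed hunion
  let β : ℕ → ℝ := fun k => 1 + 1 / ((k : ℝ) + 1)
  obtain ⟨K, hK, hKQ⟩ := exists_tendsto_atTop_of_forall_eventually fun k =>
    eventually_exists_coeffNorm_le hF hmono hclosed hunion (B := β k)
      (lt_add_of_pos_right 1 (by positivity))
  refine ⟨fun i => if hi : ∃ A : ℝ, 0 < A ∧ ∀ h : MvPolynomial (Fin d) F,
      coeffNorm h ≤ A * β (K i) ^ h.totalDegree * supNormOn (X i) h then hi.choose else 1,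
    fun i => β (K i), fun i => ?_, ?_, ?_⟩
  · dsimp only
    split_ifs with hi
    · exact hi.choose_spec.1
    · exact one_pos
  · have : Tendsto β atTop (𝓝 (1 + 0)) :=
      tendsto_const_nhds.add tendsto_one_div_add_atTop_nhds_zero_nat
    rw [add_zero] at this
    exact this.comp hK
  · filter_upwards [hKQ] with i hi h
    rw [dif_pos hi]
    exact hi.choose_spec.2 h

theorem mainTheorem4 (F : Type*) [NontriviallyNormedField F] [CompleteSpace F] [IsAlgClosed F] :
    PerfectInterpolationProperty F := by
  refine perfectInterpolationProperty_of_hasRemezMeasure fun b hb => ?_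
  by_cases h : ∀ n : ℕ, ‖(n : F)‖ ≤ 1
  · have := IsUltrametricDist.isUltrametricDist_of_forall_norm_natCast_le_one h
    exact hasRemezMeasure_of_isUltrametricDist F hb
  · exact hasRemezMeasure_of_not_bounded F h hb
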